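/- All functions are on the real line with Lebesgue measure, identities between functions hold almost everywhere, $I$ ranges over the compact intervals of positive length, $u_I=\frac1{|I|}\int_I u\,dx$, and $\inf_I$ is the essential infimum over $I$. A real-valued $f\in L^1_{loc}(\mathbb R)$ belongs to $BLO$ if $\sup_I\,[f_I-\inf_I f]<\infty$. A weight, that is, a locally integrable, almost everywhere positive function $w:\mathbb R\to[0,\infty)$, belongs to the Muckenhoupt class $A_1$ if $\sup_I \frac{w_I}{\inf_I w}<\infty$. For $g\in L^1_{loc}(\mathbb R)$ let $Mg(x)=\sup_{I\ni x}|g|_I\in[0,\infty]$ be the Hardy–Littlewood maximal function, and put $$\|f\|'_{BLO}=\inf\{\alpha+\|b\|_\infty:\ \alpha>0,\ b\in L^\infty(\mathbb R),\ \exists\, g\in L^1_{loc}(\mathbb R)\ \text{with}\ f=\alpha\log(Mg)+b\}$$ (where $\inf\emptyset=\infty$). **Theorem.** For every $f\in BLO$ the quantity $$\sigma(f)=\inf\{\mu>0:\ e^{f/\mu}\in A_1\}$$ is finite, and $$\operatorname{dist}_{BLO'}(f,L^\infty):=\inf_{h\in L^\infty}\|f-h\|'_{BLO}=\sigma(f).$$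 -/

import Mathlib

open MeasureTheory Set
open scoped ENNReal

noncomputable section

/-- The `BLO` norm `sup_I [f_I - inf_I f]` over the compact intervals `I = [a, b]`, `a < b`,
as an extended real; `inf_I` is the essential infimum (which may be `-∞`). -/
def bloNorm (f : ℝ → ℝ) : EReal :=
  ⨆ (a : ℝ) (b : ℝ) (_ : a < b),
    (((⨍ x in Icc a b, f x : ℝ) : EReal) -
      essInf (fun x => (f x : EReal)) (volume.restrict (Icc a b)))

/-- Functions of bounded lower oscillation on the real line. -/
def IsBLO (f : ℝ → ℝ) : Prop :=
  LocallyIntegrable f volume ∧ bloNorm f < ⊤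

/-- The `A₁` constant `sup_I (w_I / inf_I w)` of a nonnegative function; `inf_I` is the
essential infimum. -/
def a1Const (w : ℝ → ℝ) : ℝ≥0∞ :=
  ⨆ (a : ℝ) (b : ℝ) (_ : a < b),
    (⨍⁻ x in Icc a b, ENNReal.ofReal (w x) ∂volume) /
      essInf (fun x => ENNReal.ofReal (w x)) (volume.restrict (Icc a b))

/-- Muckenhoupt `A₁` weights on the real line. (Positivity almost everywhere excludes only the
zero function, for which the quotient defining the constant would read `0 / 0`.) -/
structure IsA1 (w : ℝ → ℝ) : Prop where
  nonneg : ∀ x, 0 ≤ w x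
  ae_pos : ∀ᵐ x, 0 < w x
  locallyIntegrable : LocallyIntegrable w volume
  a1Const_lt_top : a1Const w < ⊤

/-- The (uncentred) Hardy-Littlewood maximal function, with values in `[0, ∞]`. -/
def hlMaximal (g : ℝ → ℝ) (x : ℝ) : ℝ≥0∞ :=
  ⨆ (a : ℝ) (b : ℝ) (_ : a < b) (_ : x ∈ Icc a b), ⨍⁻ t in Icc a b, ‖g t‖ₑ ∂volume

/-- `f = α log (M g) + b` almost everywhere, with `α > 0`, `b ∈ L^∞` and `g ∈ L¹_loc`.
The logarithm takes values in `[-∞, ∞]`, so since `f` and `b` are real valued the identity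
forces `0 < M g < ∞` almost everywhere. -/
structure IsLogMaximalDecomp (f : ℝ → ℝ) (α : ℝ) (b g : ℝ → ℝ) : Prop where
  pos : 0 < α
  memLp : MemLp b ⊤ volume
  locallyIntegrable : LocallyIntegrable g volume
  ae_eq : ∀ᵐ x, (f x : EReal) = (α : EReal) * ENNReal.log (hlMaximal g x) + (b x : EReal)

/-- The new norm: the infimum of `α + ‖b‖_∞` over all decompositions `f = α log (M g) + b`
(`∞` if there is none). -/
def bloNewNorm (f : ℝ → ℝ) : ℝ≥0∞ :=
  ⨅ (α : ℝ) (b : ℝ → ℝ) (g : ℝ → ℝ) (_ : IsLogMaximalDecomp f α b g),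
    ENNReal.ofReal α + eLpNorm b ⊤ volume

/-- The distance from `f` to `L^∞` in the new norm. -/
def distNewLinfty (f : ℝ → ℝ) : ℝ≥0∞ :=
  ⨅ (h : ℝ → ℝ) (_ : MemLp h ⊤ volume), bloNewNorm (f - h)

/-- `σ(f) = inf {μ > 0 : e^{f/μ} ∈ A₁}` (`∞` if there is no such `μ`). -/
def sigmaA1 (f : ℝ → ℝ) : ℝ≥0∞ :=
  ⨅ (μ : ℝ) (_ : 0 < μ) (_ : IsA1 (fun x => Real.exp (f x / μ))), ENNReal.ofReal μ

end

/-!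
Writing `f = α log (M g) + b` means `e^{f/μ} = e^{b/μ} (M g)^{α/μ}`. By Coifman and Rochberg
`(M g)^δ` is an `A₁` weight for `δ < 1`, and multiplication by `e^{b/μ}` with `b` bounded preserves
`A₁`; hence `e^{f/μ} ∈ A₁` for every `μ > α`. Conversely, if `w = e^{f/μ}` is in `A₁`, then
`w ≤ M w ≤ K w` almost everywhere, so `f - μ log (M w)` is bounded. Since subtracting a bounded
function only changes `b`, the distance to `L^∞` is the infimum of the admissible `α`, which the
two implications identify with `σ(f)`.

Finiteness of `σ(f)` is the John–Nirenberg inequality for `BLO`. Both it and the Coifman–Rochberg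
theorem come from a Vitali covering estimate for superlevel sets, which makes the relative measure
of these sets decay geometrically along heights growing by a factor less than `2`.
-/

open Filter Metric
open scoped Topology

lemma setLAverage_Icc_le_iff {a b : ℝ} (hab : a < b) (φ : ℝ → ℝ≥0∞) (c : ℝ≥0∞) :
    ⨍⁻ x in Icc a b, φ x ∂volume ≤ c ↔ ∫⁻ x in Icc a b, φ x ≤ c * ENNReal.ofReal (b - a) := by
  rw [setLAverage_eq, Real.volume_Icc]
  exact ENNReal.div_le_iff_le_mul (.inl (ENNReal.ofReal_pos.2 (sub_pos.2 hab)).ne')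
    (.inl ENNReal.ofReal_ne_top)

lemma volume_restrict_Icc_ne_zero {a b : ℝ} (hab : a < b) : volume.restrict (Icc a b) ≠ 0 := by
  rw [Ne, Measure.restrict_eq_zero, Real.volume_Icc]
  exact (ENNReal.ofReal_pos.2 (sub_pos.2 hab)).ne'

lemma ae_tendsto_setAverage_Icc {f : ℝ → ℝ} (hf : LocallyIntegrable f) :
    ∀ᵐ x, ∀ {ι : Type*} {l : Filter ι} (p q : ι → ℝ), (∀ i, p i < q i) →
      (∀ i, x ∈ Icc (p i) (q i)) → Tendsto (fun i => q i - p i) l (𝓝 0) →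
      Tendsto (fun i => ⨍ y in Icc (p i) (q i), f y) l (𝓝 (f x)) := by
  filter_upwards [IsUnifLocDoublingMeasure.ae_tendsto_average volume hf 1]
    with x hx ι l p q hpq hxpq hlim
  have hrad : Tendsto (fun i => (q i - p i) / 2) l (𝓝[>] 0) :=
    tendsto_nhdsWithin_iff.2 ⟨by simpa using hlim.div_const 2,
      .of_forall fun i => half_pos (sub_pos.2 (hpq i))⟩
  simpa only [Real.Icc_eq_closedBall] using hx (fun i => (p i + q i) / 2) _ hrad
    (.of_forall fun i => by simpa only [one_mul, ← Real.Icc_eq_closedBall] using hxpq i)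

/-! ### Comparison of measures on Vitali covers -/

lemma measure_le_mul_of_closedBall_cover {X ι : Type*} [PseudoMetricSpace X]
    [TopologicalSpace.SeparableSpace X] [MeasurableSpace X] [OpensMeasurableSpace X]
    {μ ν : Measure X} {S : Set ι} {c : ι → X} {r : ι → ℝ} {R : ℝ} {K : ℝ≥0∞} {E F : Set X}
    (hr : ∀ i ∈ S, 0 < r i) (hR : ∀ i ∈ S, r i ≤ R) (hF : ∀ i ∈ S, closedBall (c i) (r i) ⊆ F)
    (hE : ∀ᵐ x ∂μ, x ∈ E → ∃ i ∈ S, x ∈ closedBall (c i) (r i))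
    (h : ∀ i ∈ S, μ (closedBall (c i) (5 * r i)) ≤ K * ν (closedBall (c i) (r i))) :
    μ E ≤ K * ν F := by
  obtain ⟨u, huS, hdisj, hcov⟩ :=
    Vitali.exists_disjoint_subfamily_covering_enlargement_closedBall S c r R hR 5 (by norm_num)
  have hu : u.Countable := hdisj.countable_of_nonempty_interior fun i hi =>
    ⟨c i, ball_subset_interior_closedBall (mem_ball_self (hr i (huS hi)))⟩
  calc μ E ≤ μ (⋃ i ∈ u, closedBall (c i) (5 * r i)) := by
        refine measure_mono_ae ?_
        filter_upwards [hE] with x hx hxE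
        obtain ⟨i, hi, hxi⟩ := hx hxE
        obtain ⟨j, hj, hij⟩ := hcov i hi
        exact mem_biUnion hj (hij hxi)
    _ ≤ ∑' i : u, μ (closedBall (c i) (5 * r i)) := measure_biUnion_le μ hu _
    _ ≤ ∑' i : u, K * ν (closedBall (c i) (r i)) := ENNReal.tsum_le_tsum fun i => h i (huS i.2)
    _ = K * ν (⋃ i ∈ u, closedBall (c i) (r i)) := by
        rw [ENNReal.tsum_mul_left,
          measure_biUnion hu hdisj fun i _ => isClosed_closedBall.measurableSet]
    _ ≤ K * ν F := by
        gcongr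
        exact iUnion₂_subset fun i hi => hF i (huS hi)

lemma measure_le_mul_of_Icc_cover {μ ν : Measure ℝ} {P : ℝ → ℝ → Prop} {K : ℝ≥0∞} {E : Set ℝ}
    {a b : ℝ} (hP : ∀ p q, P p q → p < q ∧ Icc p q ⊆ Icc a b)
    (hE : ∀ᵐ x ∂μ, x ∈ E → ∃ p q, P p q ∧ x ∈ Icc p q)
    (h : ∀ p q, P p q → μ (Icc (p - 2 * (q - p)) (q + 2 * (q - p))) ≤ K * ν (Icc p q)) :
    μ E ≤ K * ν (Icc a b) := by
  have hball (p q : ℝ) : closedBall ((p + q) / 2) ((q - p) / 2) = Icc p q :=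
    (Real.Icc_eq_closedBall p q).symm
  have hball5 (p q : ℝ) : closedBall ((p + q) / 2) (5 * ((q - p) / 2)) =
      Icc (p - 2 * (q - p)) (q + 2 * (q - p)) := by
    rw [Real.closedBall_eq_Icc]
    congr 1 <;> ring
  refine measure_le_mul_of_closedBall_cover (S := {I : ℝ × ℝ | P I.1 I.2})
    (c := fun I => (I.1 + I.2) / 2) (r := fun I => (I.2 - I.1) / 2) (R := (b - a) / 2)
    (fun I hI => half_pos (sub_pos.2 (hP _ _ hI).1)) (fun I hI => ?_) (fun I hI => ?_) ?_
    fun I hI => ?_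
  · obtain ⟨hlt, hsub⟩ := hP _ _ hI
    obtain ⟨ha, hb⟩ := (Icc_subset_Icc_iff hlt.le).1 hsub
    linarith
  · rw [hball]
    exact (hP _ _ hI).2
  · simpa only [mem_ofPred_eq, Prod.exists, hball] using hE
  · rw [hball, hball5]
    exact h _ _ hI

/-! ### Integrals of functions with geometric tails -/

lemma le_add_tsum_ite_pow_mul_lt {ρ c : ℝ≥0∞} (hρ : 1 ≤ ρ) (hc : c ≠ 0) (v : ℝ≥0∞) :
    v ≤ c + ∑' n : ℕ, if ρ ^ n * c < v then ρ ^ (n + 1) * c else 0 := by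
  by_cases! hex : ∃ n : ℕ, v ≤ ρ ^ n * c
  · classical
    rcases hfind : Nat.find hex with _ | n
    · exact (by simpa [hfind] using Nat.find_spec hex : v ≤ c).trans le_self_add
    · have hle : v ≤ ρ ^ (n + 1) * c := hfind ▸ Nat.find_spec hex
      have hlt : ρ ^ n * c < v := not_le.1 (Nat.find_min hex (by omega))
      calc v ≤ if ρ ^ n * c < v then ρ ^ (n + 1) * c else 0 := by rwa [if_pos hlt]
        _ ≤ ∑' n : ℕ, if ρ ^ n * c < v then ρ ^ (n + 1) * c else 0 := ENNReal.le_tsum n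
        _ ≤ _ := le_add_self
  · have htop : ∑' n : ℕ, (if ρ ^ n * c < v then ρ ^ (n + 1) * c else 0) = ⊤ := by
      refine top_unique ((ENNReal.tsum_const_eq_top_of_ne_zero (α := ℕ) hc).ge.trans ?_)
      refine ENNReal.tsum_le_tsum fun n => ?_
      rw [if_pos (hex n)]
      exact le_mul_of_one_le_left' (one_le_pow_of_one_le' hρ _)
    simp [htop]

/-- The constant in the integral bound for functions whose superlevel sets at the heights `ρ ^ n`
have relative measure at most `A * 2⁻¹ ^ n`; it is finite when `A < ∞` and `ρ < 2`. -/
noncomputable def geometricTailConst (A ρ : ℝ≥0∞) : ℝ≥0∞ := 1 + A * ρ * (1 - ρ * 2⁻¹)⁻¹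

lemma geometricTailConst_ne_zero (A ρ : ℝ≥0∞) : geometricTailConst A ρ ≠ 0 := by
  simp [geometricTailConst]

lemma geometricTailConst_ne_top {A ρ : ℝ≥0∞} (hA : A ≠ ⊤) (hρ : ρ < 2) :
    geometricTailConst A ρ ≠ ⊤ := by
  have hhalf : ρ * 2⁻¹ < 1 := by
    rw [← div_eq_mul_inv]
    exact ENNReal.div_lt_of_lt_mul (by simpa using hρ)
  exact ENNReal.add_ne_top.2 ⟨ENNReal.one_ne_top, ENNReal.mul_ne_top
    (ENNReal.mul_ne_top hA hρ.ne_top) (ENNReal.inv_ne_top.2 (tsub_pos_of_lt hhalf).ne')⟩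

lemma lintegral_le_of_geometric_tail {Ω : Type*} [MeasurableSpace Ω] {ν : Measure Ω}
    {v : Ω → ℝ≥0∞} {A ρ c : ℝ≥0∞} (hρ : 1 ≤ ρ) (hc : c ≠ 0)
    (htail : ∀ n : ℕ, ν {x | ρ ^ n * c < v x} ≤ A * 2⁻¹ ^ n * ν univ) :
    ∫⁻ x, v x ∂ν ≤ geometricTailConst A ρ * c * ν univ := by
  set S : ℕ → Set Ω := fun n => toMeasurable ν {x | ρ ^ n * c < v x}
  have hS (n : ℕ) : MeasurableSet (S n) := measurableSet_toMeasurable _ _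
  have hle (x : Ω) : v x ≤ c + ∑' n, (S n).indicator (fun _ => ρ ^ (n + 1) * c) x := by
    classical
    refine (le_add_tsum_ite_pow_mul_lt hρ hc (v x)).trans ?_
    gcongr with n
    split_ifs with hn
    · rw [indicator_of_mem (subset_toMeasurable ν _ hn)]
    · exact zero_le
  calc ∫⁻ x, v x ∂ν ≤ ∫⁻ x, (c + ∑' n, (S n).indicator (fun _ => ρ ^ (n + 1) * c) x) ∂ν :=
        lintegral_mono hle
    _ = c * ν univ + ∑' n, ρ ^ (n + 1) * c * ν {x | ρ ^ n * c < v x} := by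
        rw [lintegral_add_left measurable_const, lintegral_const,
          lintegral_tsum fun n => (measurable_const.indicator (hS n)).aemeasurable]
        simp only [lintegral_indicator_const (hS _), S, measure_toMeasurable]
    _ ≤ c * ν univ + ∑' n, A * ρ * c * ν univ * (ρ * 2⁻¹) ^ n := by
        refine add_le_add_right (ENNReal.tsum_le_tsum fun n => ?_) _
        calc ρ ^ (n + 1) * c * ν {x | ρ ^ n * c < v x}
            ≤ ρ ^ (n + 1) * c * (A * 2⁻¹ ^ n * ν univ) := by gcongr; exact htail n
          _ = A * ρ * c * ν univ * (ρ * 2⁻¹) ^ n := by rw [mul_pow]; ring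
    _ = geometricTailConst A ρ * c * ν univ := by
        rw [ENNReal.tsum_mul_left, ENNReal.tsum_geometric, geometricTailConst]
        ring

/-! ### Interval conditions in almost everywhere form -/

/-- `f` has lower oscillation at most `C`: its mean over any compact interval exceeds its essential
infimum there by at most `C`. The essential infimum is expressed through almost every value, which
avoids extended reals. -/
def HasLowerOscillationBound (f : ℝ → ℝ) (C : ℝ) : Prop :=
  ∀ a b, a < b → ∀ᵐ x ∂volume.restrict (Icc a b), ⨍ t in Icc a b, f t ≤ f x + C

/-- The `A₁` inequality `w_I ≤ K inf_I w` for `[0, ∞]`-valued functions, without measurability or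
local integrability. The essential infimum is expressed through almost every value. -/
def HasA1Bound (w : ℝ → ℝ≥0∞) (K : ℝ≥0∞) : Prop :=
  ∀ a b, a < b → ∀ᵐ x ∂volume.restrict (Icc a b), ⨍⁻ t in Icc a b, w t ∂volume ≤ K * w x

lemma IsBLO.exists_hasLowerOscillationBound {f : ℝ → ℝ} (hf : IsBLO f) :
    ∃ C > 0, HasLowerOscillationBound f C := by
  obtain ⟨C, hC, -⟩ := EReal.lt_iff_exists_real_btwn.1 hf.2
  refine ⟨max C 1, by positivity, fun a b hab => ?_⟩
  have hosc : ((⨍ x in Icc a b, f x : ℝ) : EReal) -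
      essInf (fun x => (f x : EReal)) (volume.restrict (Icc a b)) ≤ C :=
    hC.le.trans' (le_iSup_of_le a (le_iSup₂_of_le b hab le_rfl))
  rw [EReal.sub_le_iff_le_add (.inr (EReal.coe_ne_top _)) (.inr (EReal.coe_ne_bot _))] at hosc
  filter_upwards [ae_essInf_le (f := fun x => (f x : EReal))
    (μ := volume.restrict (Icc a b))] with x hx
  have hle := hosc.trans (add_le_add_right hx (C : EReal))
  rw [← EReal.coe_add, EReal.coe_le_coe_iff] at hle
  linarith [le_max_left C 1]

lemma IsA1.exists_hasA1Bound {w : ℝ → ℝ} (hw : IsA1 w) :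
    ∃ K ≠ ⊤, HasA1Bound (fun x => ENNReal.ofReal (w x)) K := by
  refine ⟨a1Const w + 1, ENNReal.add_ne_top.2 ⟨hw.a1Const_lt_top.ne, by simp⟩, fun a b hab => ?_⟩
  have hratio : (⨍⁻ t in Icc a b, ENNReal.ofReal (w t) ∂volume) /
      essInf (fun x => ENNReal.ofReal (w x)) (volume.restrict (Icc a b)) ≤ a1Const w + 1 :=
    le_add_right (le_iSup_of_le a (le_iSup₂_of_le b hab le_rfl))
  rw [ENNReal.div_le_iff_le_mul (.inr (by simp [hw.a1Const_lt_top.ne])) (.inr (by simp))] at hratio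
  filter_upwards [ae_essInf_le (f := fun x => ENNReal.ofReal (w x))
    (μ := volume.restrict (Icc a b))] with x hx
  exact hratio.trans (by gcongr)

lemma HasA1Bound.a1Const_le {w : ℝ → ℝ} {K : ℝ≥0∞}
    (h : HasA1Bound (fun x => ENNReal.ofReal (w x)) K) (hK : K ≠ 0) (hK' : K ≠ ⊤) :
    a1Const w ≤ K := by
  refine iSup_le fun a => iSup₂_le fun b hab => ENNReal.div_le_of_le_mul ?_
  rw [mul_comm, ← ENNReal.div_le_iff hK hK']
  refine le_essInf_of_ae_le _ ?_
  filter_upwards [h a b hab] with x hx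
  rwa [ENNReal.div_le_iff hK hK', mul_comm]

lemma HasA1Bound.locallyIntegrable {w : ℝ → ℝ} {K : ℝ≥0∞}
    (h : HasA1Bound (fun x => ENNReal.ofReal (w x)) K) (hK : K ≠ ⊤) (hw : ∀ x, 0 ≤ w x)
    (hwm : AEMeasurable w) : LocallyIntegrable w := by
  intro x
  have hlt : x - 1 < x + 1 := by linarith
  refine ⟨Icc (x - 1) (x + 1), Icc_mem_nhds (by linarith) (by linarith),
    hwm.aestronglyMeasurable.restrict, ?_⟩
  have := ae_neBot.2 (volume_restrict_Icc_ne_zero hlt)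
  obtain ⟨y, hy⟩ := (h _ _ hlt).exists
  rw [setLAverage_Icc_le_iff hlt] at hy
  rw [hasFiniteIntegral_iff_ofReal (ae_of_all _ hw)]
  exact hy.trans_lt (by finiteness)

lemma HasA1Bound.mono {w : ℝ → ℝ≥0∞} {K L : ℝ≥0∞} (h : HasA1Bound w K) (hKL : K ≤ L) :
    HasA1Bound w L :=
  fun a b hab => (h a b hab).mono fun _ hx => hx.trans (by gcongr)

lemma HasA1Bound.isA1 {w : ℝ → ℝ} {K : ℝ≥0∞} (h : HasA1Bound (fun x => ENNReal.ofReal (w x)) K)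
    (hK : K ≠ ⊤) (hw : ∀ x, 0 ≤ w x) (hpos : ∀ᵐ x, 0 < w x) (hwm : AEMeasurable w) : IsA1 w where
  nonneg := hw
  ae_pos := hpos
  locallyIntegrable := h.locallyIntegrable hK hw hwm
  a1Const_lt_top :=
    ((h.mono (le_self_add (b := 1))).a1Const_le (by simp) (by finiteness)).trans_lt (by finiteness)

lemma HasA1Bound.of_le_mul {v w : ℝ → ℝ≥0∞} {K E₁ E₂ : ℝ≥0∞} (h : HasA1Bound v K) (hE₁ : E₁ ≠ ⊤)
    (hwv : ∀ᵐ x, w x ≤ E₁ * v x) (hvw : ∀ᵐ x, v x ≤ E₂ * w x) : HasA1Bound w (E₁ * K * E₂) := by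
  intro a b hab
  filter_upwards [h a b hab, ae_restrict_of_ae hvw] with x hx hxvw
  rw [setLAverage_Icc_le_iff hab] at hx ⊢
  calc ∫⁻ t in Icc a b, w t ≤ ∫⁻ t in Icc a b, E₁ * v t :=
        lintegral_mono_ae (ae_restrict_of_ae hwv)
    _ = E₁ * ∫⁻ t in Icc a b, v t := lintegral_const_mul' _ _ hE₁
    _ ≤ E₁ * (K * (E₂ * w x) * ENNReal.ofReal (b - a)) := by
        gcongr
        exact hx.trans (by gcongr)
    _ = E₁ * K * E₂ * w x * ENNReal.ofReal (b - a) := by ring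

lemma HasA1Bound.of_ae_eq_exp_mul {v w : ℝ → ℝ≥0∞} {β : ℝ → ℝ} {K : ℝ≥0∞} {N : ℝ}
    (h : HasA1Bound v K) (hβ : ∀ᵐ x, |β x| ≤ N)
    (hw : ∀ᵐ x, w x = ENNReal.ofReal (Real.exp (β x)) * v x) :
    HasA1Bound w (ENNReal.ofReal (Real.exp N) * K * ENNReal.ofReal (Real.exp N)) := by
  refine h.of_le_mul ENNReal.ofReal_ne_top ?_ ?_
  · filter_upwards [hβ, hw] with x hβx hwx
    rw [hwx]
    gcongr
    exact le_of_abs_le hβx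
  · filter_upwards [hβ, hw] with x hβx hwx
    rw [hwx, ← mul_assoc, ← ENNReal.ofReal_mul (Real.exp_pos _).le, ← Real.exp_add]
    refine le_mul_of_one_le_left' (ENNReal.one_le_ofReal.2 (Real.one_le_exp ?_))
    linarith [neg_le_of_abs_le hβx]

/-! ### The John–Nirenberg inequality for `BLO` -/

lemma setIntegral_Icc_eq_average_mul {a b : ℝ} (hab : a ≤ b) (f : ℝ → ℝ) :
    ∫ x in Icc a b, f x = (⨍ x in Icc a b, f x) * (b - a) := by
  rw [← measure_smul_setAverage f (by simp), Real.volume_real_Icc_of_le hab, smul_eq_mul, mul_comm]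

lemma HasLowerOscillationBound.average_le {f : ℝ → ℝ} {C : ℝ} (h : HasLowerOscillationBound f C)
    (hf : LocallyIntegrable f) {a b a' b' : ℝ} (hab : a < b) (hsub : Icc a b ⊆ Icc a' b') :
    ⨍ x in Icc a' b', f x ≤ (⨍ x in Icc a b, f x) + C := by
  obtain ⟨ha, hb⟩ := (Icc_subset_Icc_iff hab.le).1 hsub
  have hnull := ae_restrict_of_ae_restrict_of_subset hsub (h a' b' (by linarith))
  obtain ⟨x, hx, hxle⟩ := exists_notMem_null_le_average (volume_restrict_Icc_ne_zero hab)
    (hf.integrableOn_isCompact isCompact_Icc) (ae_iff.1 hnull)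
  have hxC : ⨍ x in Icc a' b', f x ≤ f x + C := not_not.1 hx
  linarith

lemma HasLowerOscillationBound.lintegral_ofReal_sub_le {f : ℝ → ℝ} {C : ℝ}
    (h : HasLowerOscillationBound f C) (hf : LocallyIntegrable f) {a b t : ℝ} (hab : a < b)
    (ht : ⨍ x in Icc a b, f x ≤ t + C) :
    ∫⁻ x in Icc a b, ENNReal.ofReal (f x - t) ≤ ENNReal.ofReal (C * (b - a)) := by
  set m := ⨍ x in Icc a b, f x
  have hint : IntegrableOn f (Icc a b) := hf.integrableOn_isCompact isCompact_Icc
  calc ∫⁻ x in Icc a b, ENNReal.ofReal (f x - t)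
      ≤ ∫⁻ x in Icc a b, ENNReal.ofReal (f x - (m - C)) :=
        lintegral_mono fun x => ENNReal.ofReal_le_ofReal (by linarith)
    _ = ENNReal.ofReal (∫ x in Icc a b, (f x - (m - C))) := by
        refine (ofReal_integral_eq_lintegral_ofReal (hint.sub (integrable_const _)) ?_).symm
        filter_upwards [h a b hab] with x hx
        simp only [Pi.zero_apply, Pi.sub_apply]
        linarith
    _ = ENNReal.ofReal (C * (b - a)) := by
        rw [integral_sub hint (integrable_const _), setIntegral_Icc_eq_average_mul hab.le,
          setIntegral_const, Real.volume_real_Icc_of_le hab.le, smul_eq_mul]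
        congr 1
        ring

/-- `[p, q]` is a stopping interval for `f` at height `t` in the sense of Calderón and Zygmund: the
mean of `f` over it is at most `t`, but exceeds `t` on one of its subintervals of half the length.
These intervals do not come from a fixed dyadic grid and may overlap. -/
structure IsStoppingInterval (f : ℝ → ℝ) (t p q : ℝ) : Prop where
  lt : p < q
  average_le : ⨍ x in Icc p q, f x ≤ t
  exists_half : ∃ p' q', q' - p' = (q - p) / 2 ∧ Icc p' q' ⊆ Icc p q ∧ t < ⨍ x in Icc p' q', f x

lemma ae_exists_isStoppingInterval {f : ℝ → ℝ} (hf : LocallyIntegrable f) {a b t : ℝ} (hab : a < b)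
    (ht : ⨍ x in Icc a b, f x ≤ t) :
    ∀ᵐ x, x ∈ Icc a b → t < f x →
      ∃ p q, (IsStoppingInterval f t p q ∧ Icc p q ⊆ Icc a b) ∧ x ∈ Icc p q := by
  filter_upwards [ae_tendsto_setAverage_Icc hf] with x hlim ⟨hax, hxb⟩ hxt
  -- Halve the interval towards `x`: the one before the mean first exceeds `t` is stopping.
  set p : ℕ → ℝ := fun n => x + (1 / 2) ^ n * (a - x) with hp
  set q : ℕ → ℝ := fun n => x + (1 / 2) ^ n * (b - x) with hq
  have hpx (n : ℕ) : p n ≤ x := by simp only [hp]; nlinarith [pow_pos (one_half_pos (α := ℝ)) n]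
  have hxq (n : ℕ) : x ≤ q n := by simp only [hq]; nlinarith [pow_pos (one_half_pos (α := ℝ)) n]
  have hlen (n : ℕ) : q n - p n = (1 / 2) ^ n * (b - a) := by simp only [hp, hq]; ring
  have hlt (n : ℕ) : p n < q n := sub_pos.1 (hlen n ▸ mul_pos (by positivity) (sub_pos.2 hab))
  have hp_succ (n : ℕ) : p (n + 1) = (p n + x) / 2 := by simp only [hp]; ring
  have hq_succ (n : ℕ) : q (n + 1) = (q n + x) / 2 := by simp only [hq]; ring
  have hanti : Antitone fun n => Icc (p n) (q n) := antitone_nat_of_succ_le fun n =>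
    Icc_subset_Icc (by linarith [hpx n, hp_succ n]) (by linarith [hxq n, hq_succ n])
  have hzero : Icc (p 0) (q 0) = Icc a b := by simp [hp, hq]
  have htend : Tendsto (fun n => q n - p n) atTop (𝓝 0) := by
    simpa only [hlen, zero_mul] using (tendsto_pow_atTop_nhds_zero_of_lt_one
      (by norm_num) (by norm_num : (1 / 2 : ℝ) < 1)).mul_const (b - a)
  have hex : ∃ n, t < ⨍ y in Icc (p n) (q n), f y :=
    ((hlim p q hlt (fun n => ⟨hpx n, hxq n⟩) htend).eventually (lt_mem_nhds hxt)).exists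
  classical
  have hspec := Nat.find_spec hex
  rcases hfind : Nat.find hex with _ | n
  · rw [hfind, hzero] at hspec
    exact absurd ht hspec.not_ge
  · rw [hfind] at hspec
    refine ⟨p n, q n, ⟨⟨hlt n, not_lt.1 (Nat.find_min hex (by omega)), p (n + 1), q (n + 1), ?_,
      hanti n.le_succ, hspec⟩, hzero ▸ hanti n.zero_le⟩, hpx n, hxq n⟩
    linarith [hp_succ n, hq_succ n]

lemma HasLowerOscillationBound.setLIntegral_enlargement_le {f : ℝ → ℝ} {C : ℝ}
    (h : HasLowerOscillationBound f C) (hf : LocallyIntegrable f) {t p q : ℝ}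
    (hpq : IsStoppingInterval f t p q) :
    ∫⁻ x in Icc (p - 2 * (q - p)) (q + 2 * (q - p)), ENNReal.ofReal (f x - t) ≤
      ENNReal.ofReal (10 * C) * volume.restrict {x | t - C < f x} (Icc p q) := by
  have hlt := hpq.lt
  obtain ⟨p', q', hlen, hsub, hgt⟩ := hpq.exists_half
  have hsuper : Icc p' q' ≤ᵐ[volume] (Icc p q ∩ {x | t - C < f x} : Set ℝ) := by
    filter_upwards [(ae_restrict_iff' measurableSet_Icc).1 (h p' q' (by linarith))] with x hx hxI
    exact ⟨hsub hxI, by simp only [mem_ofPred_eq]; linarith [hx hxI]⟩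
  calc _ ≤ ENNReal.ofReal (C * (q + 2 * (q - p) - (p - 2 * (q - p)))) :=
        h.lintegral_ofReal_sub_le hf (by linarith) <| (h.average_le hf hlt
          (Icc_subset_Icc (by linarith) (by linarith))).trans (by linarith [hpq.average_le])
    _ = ENNReal.ofReal (10 * C) * volume (Icc p' q') := by
        rw [Real.volume_Icc, ← ENNReal.ofReal_mul' (by linarith), hlen]
        congr 1
        ring
    _ ≤ _ := by
        rw [Measure.restrict_apply measurableSet_Icc]
        exact mul_le_mul_right (measure_mono_ae hsuper) _

lemma HasLowerOscillationBound.lintegral_ofReal_sub_le_measure {f : ℝ → ℝ} {C : ℝ}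
    (h : HasLowerOscillationBound f C) (hf : LocallyIntegrable f) {a b t : ℝ} (hab : a < b)
    (ht : ⨍ x in Icc a b, f x ≤ t) :
    ∫⁻ x in Icc a b, ENNReal.ofReal (f x - t) ≤
      ENNReal.ofReal (10 * C) * volume.restrict (Icc a b) {x | t - C < f x} := by
  have hφ : AEMeasurable (fun x => ENNReal.ofReal (f x - t)) :=
    (hf.aestronglyMeasurable.aemeasurable.sub_const t).ennreal_ofReal
  have hcover := measure_le_mul_of_Icc_cover (E := Icc a b) (a := a) (b := b)
    (μ := volume.withDensity fun x => ENNReal.ofReal (f x - t))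
    (ν := volume.restrict {x | t - C < f x})
    (P := fun p q => IsStoppingInterval f t p q ∧ Icc p q ⊆ Icc a b) (K := ENNReal.ofReal (10 * C))
    (fun p q hpq => ⟨hpq.1.lt, hpq.2⟩)
    ((ae_withDensity_iff' hφ).2 ?_) fun p q hpq => ?_
  · rw [withDensity_apply _ measurableSet_Icc] at hcover
    rwa [Measure.restrict_apply' measurableSet_Icc, inter_comm,
      ← Measure.restrict_apply measurableSet_Icc]
  · filter_upwards [ae_exists_isStoppingInterval hf hab ht] with x hx hne hxI
    exact hx hxI (sub_pos.1 (ENNReal.ofReal_pos.1 (pos_iff_ne_zero.2 hne)))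
  · rw [withDensity_apply _ measurableSet_Icc]
    exact h.setLIntegral_enlargement_le hf hpq.1

lemma HasLowerOscillationBound.measure_superlevel_le_half {f : ℝ → ℝ} {C : ℝ}
    (h : HasLowerOscillationBound f C) (hf : LocallyIntegrable f) (hC : 0 < C) {a b t : ℝ}
    (hab : a < b) (ht : ⨍ x in Icc a b, f x ≤ t) :
    volume.restrict (Icc a b) {x | t + 20 * C < f x} ≤
      2⁻¹ * volume.restrict (Icc a b) {x | t - C < f x} := by
  set ν := volume.restrict (Icc a b)
  have hφ : AEMeasurable (fun x => ENNReal.ofReal (f x - t)) ν :=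
    (hf.aestronglyMeasurable.aemeasurable.sub_const t).ennreal_ofReal.restrict
  have hchebyshev : ENNReal.ofReal (10 * C) * (2 * ν {x | t + 20 * C < f x}) ≤
      ENNReal.ofReal (10 * C) * ν {x | t - C < f x} := by
    calc ENNReal.ofReal (10 * C) * (2 * ν {x | t + 20 * C < f x})
        = ENNReal.ofReal (20 * C) * ν {x | t + 20 * C < f x} := by
          rw [← mul_assoc, ← ENNReal.ofReal_ofNat 2, ← ENNReal.ofReal_mul (by positivity)]
          congr 2
          ring
      _ ≤ ENNReal.ofReal (20 * C) * ν {x | ENNReal.ofReal (20 * C) ≤ ENNReal.ofReal (f x - t)} := by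
          refine mul_le_mul_right (measure_mono fun x hx => ENNReal.ofReal_le_ofReal ?_) _
          exact (lt_sub_iff_add_lt'.2 hx).le
      _ ≤ ∫⁻ x, ENNReal.ofReal (f x - t) ∂ν := mul_meas_ge_le_lintegral₀ hφ _
      _ ≤ _ := h.lintegral_ofReal_sub_le_measure hf hab ht
  rw [ENNReal.mul_le_mul_iff_right (by simpa using hC) ENNReal.ofReal_ne_top] at hchebyshev
  rwa [mul_comm 2⁻¹, ← div_eq_mul_inv, ENNReal.le_div_iff_mul_le (by simp) (by simp), mul_comm]

lemma HasLowerOscillationBound.measure_superlevel_le {f : ℝ → ℝ} {C : ℝ}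
    (h : HasLowerOscillationBound f C) (hf : LocallyIntegrable f) (hC : 0 < C) {a b : ℝ}
    (hab : a < b) (n : ℕ) :
    volume.restrict (Icc a b) {x | (⨍ y in Icc a b, f y) + 21 * C * n - C < f x} ≤
      2⁻¹ ^ n * volume.restrict (Icc a b) univ := by
  set m := ⨍ y in Icc a b, f y
  induction n with
  | zero => simpa using measure_mono (μ := volume.restrict (Icc a b)) (subset_univ _)
  | succ n ih =>
    have hstep := h.measure_superlevel_le_half hf hC hab (t := m + 21 * C * n)
      (le_add_of_nonneg_right (by positivity))
    calc _ = volume.restrict (Icc a b) {x | m + 21 * C * n + 20 * C < f x} := by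
          push_cast
          ring_nf
      _ ≤ 2⁻¹ * (2⁻¹ ^ n * volume.restrict (Icc a b) univ) := hstep.trans (by gcongr)
      _ = _ := by rw [pow_succ', mul_assoc]

lemma HasLowerOscillationBound.hasA1Bound_exp_div {f : ℝ → ℝ} {C : ℝ}
    (h : HasLowerOscillationBound f C) (hf : LocallyIntegrable f) (hC : 0 < C) :
    HasA1Bound (fun x => ENNReal.ofReal (Real.exp (f x / (42 * C))))
      (geometricTailConst 1 (ENNReal.ofReal (Real.exp (1 / 2)))) := by
  intro a b hab
  set m := ⨍ t in Icc a b, f t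
  have hlevel (n : ℕ) : {x | ENNReal.ofReal (Real.exp (1 / 2)) ^ n *
      ENNReal.ofReal (Real.exp ((m - C) / (42 * C))) <
        ENNReal.ofReal (Real.exp (f x / (42 * C)))} = {x | m + 21 * C * n - C < f x} := by
    ext x
    simp only [mem_ofPred_eq]
    rw [← ENNReal.ofReal_pow (Real.exp_pos _).le, ← ENNReal.ofReal_mul (by positivity),
      ENNReal.ofReal_lt_ofReal_iff (Real.exp_pos _), ← Real.exp_nat_mul, ← Real.exp_add,
      Real.exp_lt_exp, lt_div_iff₀ (by positivity)]
    have hexponent : (n * (1 / 2) + (m - C) / (42 * C)) * (42 * C) = m + 21 * C * n - C := by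
      field_simp
      ring
    rw [hexponent]
  have hmean := lintegral_le_of_geometric_tail (ν := volume.restrict (Icc a b))
    (v := fun x => ENNReal.ofReal (Real.exp (f x / (42 * C)))) (A := 1)
    (ρ := ENNReal.ofReal (Real.exp (1 / 2))) (c := ENNReal.ofReal (Real.exp ((m - C) / (42 * C))))
    (ENNReal.one_le_ofReal.2 (Real.one_le_exp (by norm_num)))
    (ENNReal.ofReal_pos.2 (Real.exp_pos _)).ne'
    fun n => by rw [hlevel, one_mul]; exact h.measure_superlevel_le hf hC hab n
  filter_upwards [h a b hab] with x hx
  rw [setLAverage_Icc_le_iff hab]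
  rw [Measure.restrict_apply_univ, Real.volume_Icc] at hmean
  refine hmean.trans ?_
  gcongr
  linarith

lemma IsBLO.sigmaA1_lt_top {f : ℝ → ℝ} (hf : IsBLO f) : sigmaA1 f < ⊤ := by
  obtain ⟨C, hC, hosc⟩ := hf.exists_hasLowerOscillationBound
  have hexp : Real.exp (1 / 2) < 2 := by
    rw [← Real.lt_log_iff_exp_lt two_pos]
    linarith [Real.log_two_gt_d9]
  have hA1 : IsA1 fun x => Real.exp (f x / (42 * C)) :=
    (hosc.hasA1Bound_exp_div hf.1 hC).isA1
      (geometricTailConst_ne_top ENNReal.one_ne_top (by simpa using hexp))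
      (fun x => (Real.exp_pos _).le) (ae_of_all _ fun x => Real.exp_pos _)
      (Real.measurable_exp.comp_aemeasurable
        (hf.1.aestronglyMeasurable.aemeasurable.div_const _))
  exact (iInf₂_le_of_le (42 * C) (by positivity) (iInf_le _ hA1)).trans_lt ENNReal.ofReal_lt_top

/-! ### The maximal function and the Coifman–Rochberg theorem -/

lemma setLAverage_le_hlMaximal (g : ℝ → ℝ) {a b x : ℝ} (hab : a < b) (hx : x ∈ Icc a b) :
    ⨍⁻ t in Icc a b, ‖g t‖ₑ ∂volume ≤ hlMaximal g x :=
  le_iSup_of_le a (le_iSup_of_le b (le_iSup₂_of_le hab hx le_rfl))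

lemma setLIntegral_le_hlMaximal_mul (g : ℝ → ℝ) {a b x : ℝ} (hab : a < b) (hx : x ∈ Icc a b) :
    ∫⁻ t in Icc a b, ‖g t‖ₑ ≤ hlMaximal g x * ENNReal.ofReal (b - a) :=
  (setLAverage_Icc_le_iff hab _ _).1 (setLAverage_le_hlMaximal g hab hx)

lemma hlMaximal_le_iff {g : ℝ → ℝ} {x : ℝ} {s : ℝ≥0∞} :
    hlMaximal g x ≤ s ↔ ∀ a b, a < b → x ∈ Icc a b →
      ∫⁻ t in Icc a b, ‖g t‖ₑ ≤ s * ENNReal.ofReal (b - a) := by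
  simp only [hlMaximal, iSup_le_iff]
  exact forall₃_congr fun a b hab => by rw [setLAverage_Icc_le_iff hab]

lemma hlMaximal_eq_zero_of_eq_zero {g : ℝ → ℝ} {y : ℝ} (hy : hlMaximal g y = 0) (x : ℝ) :
    hlMaximal g x = 0 := by
  refine nonpos_iff_eq_zero.1 (hlMaximal_le_iff.2 fun a b hab _ => ?_)
  have hlt : min a y < max b y := (min_le_left _ _).trans_lt (hab.trans_le (le_max_left _ _))
  calc ∫⁻ t in Icc a b, ‖g t‖ₑ ≤ ∫⁻ t in Icc (min a y) (max b y), ‖g t‖ₑ :=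
        lintegral_mono_set (Icc_subset_Icc (min_le_left _ _) (le_max_left _ _))
    _ ≤ hlMaximal g y * ENNReal.ofReal (max b y - min a y) :=
        setLIntegral_le_hlMaximal_mul g hlt ⟨min_le_right _ _, le_max_right _ _⟩
    _ = 0 * ENNReal.ofReal (b - a) := by rw [hy, zero_mul, zero_mul]

lemma exists_Icc_lt_of_two_mul_hlMaximal_le {g : ℝ → ℝ} {a b x y : ℝ} {s : ℝ≥0∞}
    (hx : x ∈ Icc a b) (hy : y ∈ Icc a b) (hys : 2 * hlMaximal g y ≤ s) (hxs : s < hlMaximal g x) :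
    ∃ p q, p < q ∧ q - p < b - a ∧ x ∈ Icc p q ∧
      s * ENNReal.ofReal (q - p) < ∫⁻ t in Icc p q, ‖g t‖ₑ := by
  have hnot := hlMaximal_le_iff.not.1 hxs.not_ge
  push Not at hnot
  obtain ⟨p, q, hpq, hxpq, hlt⟩ := hnot
  refine ⟨p, q, hpq, ?_, hxpq, hlt⟩
  -- Otherwise the hull of `[p, q]` and `[a, b]` contains `y` and is at most twice as long as
  -- `[p, q]`, so the mean over `[p, q]` is at most `2 M g y`.
  by_contra! hlong
  refine hlt.not_ge ?_
  have hhull : min a p < max b q := (min_le_right _ _).trans_lt (hpq.trans_le (le_max_right _ _))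
  have hlen : max b q - min a p ≤ 2 * (q - p) := by
    rcases max_cases b q with h | h <;> rcases min_cases a p with h' | h' <;>
      linarith [hx.1, hx.2, hxpq.1, hxpq.2]
  calc ∫⁻ t in Icc p q, ‖g t‖ₑ ≤ ∫⁻ t in Icc (min a p) (max b q), ‖g t‖ₑ :=
        lintegral_mono_set (Icc_subset_Icc (min_le_right _ _) (le_max_right _ _))
    _ ≤ hlMaximal g y * ENNReal.ofReal (max b q - min a p) :=
        setLIntegral_le_hlMaximal_mul g hhull
          ⟨(min_le_left _ _).trans hy.1, hy.2.trans (le_max_left _ _)⟩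
    _ ≤ hlMaximal g y * ENNReal.ofReal (2 * (q - p)) := by gcongr
    _ = 2 * hlMaximal g y * ENNReal.ofReal (q - p) := by
        rw [ENNReal.ofReal_mul (by norm_num), ENNReal.ofReal_ofNat]
        ring
    _ ≤ s * ENNReal.ofReal (q - p) := by gcongr

lemma mul_measure_lt_hlMaximal_le (g : ℝ → ℝ) {a b y : ℝ} (hab : a < b) (hy : y ∈ Icc a b)
    (s : ℝ≥0∞) :
    s * volume.restrict (Icc a b) {x | s < hlMaximal g x} ≤
      15 * hlMaximal g y * ENNReal.ofReal (b - a) := by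
  rcases le_or_gt s (2 * hlMaximal g y) with hs | hs
  · calc s * volume.restrict (Icc a b) {x | s < hlMaximal g x}
        ≤ 15 * hlMaximal g y * volume.restrict (Icc a b) univ := by
          refine mul_le_mul' (hs.trans ?_) (measure_mono (subset_univ _))
          gcongr
          norm_num
      _ = 15 * hlMaximal g y * ENNReal.ofReal (b - a) := by
          rw [Measure.restrict_apply_univ, Real.volume_Icc]
  have hcover := measure_le_mul_of_Icc_cover (K := 5) (E := {x | s < hlMaximal g x} ∩ Icc a b)
    (a := a - (b - a)) (b := b + (b - a)) (μ := s • volume)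
    (ν := volume.withDensity fun t => ‖g t‖ₑ)
    (P := fun p q => (p < q ∧ Icc p q ⊆ Icc (a - (b - a)) (b + (b - a))) ∧
      s * ENNReal.ofReal (q - p) ≤ ∫⁻ t in Icc p q, ‖g t‖ₑ)
    (fun p q hpq => hpq.1) (.of_forall fun x ⟨hsx, hxI⟩ => ?_) fun p q ⟨_, hle⟩ => ?_
  · calc s * volume.restrict (Icc a b) {x | s < hlMaximal g x}
        ≤ 5 * ∫⁻ t in Icc (a - (b - a)) (b + (b - a)), ‖g t‖ₑ := by
          rwa [withDensity_apply _ measurableSet_Icc, Measure.smul_apply, smul_eq_mul,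
            ← Measure.restrict_apply' measurableSet_Icc] at hcover
      _ ≤ 5 * (hlMaximal g y * ENNReal.ofReal (b + (b - a) - (a - (b - a)))) := by
          gcongr
          exact setLIntegral_le_hlMaximal_mul g (by linarith)
            ⟨by linarith [hy.1], by linarith [hy.2]⟩
      _ = 15 * hlMaximal g y * ENNReal.ofReal (b - a) := by
          rw [show b + (b - a) - (a - (b - a)) = 3 * (b - a) by ring,
            ENNReal.ofReal_mul (by norm_num), ENNReal.ofReal_ofNat]
          ring
  · obtain ⟨p, q, hpq, hshort, hxpq, hlt⟩ := exists_Icc_lt_of_two_mul_hlMaximal_le hxI hy hs.le hsx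
    refine ⟨p, q, ⟨⟨hpq, ?_⟩, hlt.le⟩, hxpq⟩
    exact Icc_subset_Icc (by linarith [hxI.1, hxpq.2]) (by linarith [hxI.2, hxpq.1])
  · rw [withDensity_apply _ measurableSet_Icc, Measure.smul_apply, smul_eq_mul, Real.volume_Icc,
      show q + 2 * (q - p) - (p - 2 * (q - p)) = 5 * (q - p) by ring,
      ENNReal.ofReal_mul (by norm_num), ENNReal.ofReal_ofNat, mul_left_comm]
    gcongr

lemma hasA1Bound_hlMaximal_rpow (g : ℝ → ℝ) {δ : ℝ} (hδ : 0 < δ) :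
    HasA1Bound (fun x => hlMaximal g x ^ δ) (geometricTailConst 15 (2 ^ δ)) := by
  intro a b hab
  filter_upwards [ae_restrict_mem measurableSet_Icc] with y hy
  rw [setLAverage_Icc_le_iff hab]
  set m := hlMaximal g y with hm
  rcases eq_or_ne m 0 with hm0 | hm0
  · simp [hlMaximal_eq_zero_of_eq_zero (hm.symm.trans hm0), ENNReal.zero_rpow_of_pos hδ]
  rcases eq_or_ne m ⊤ with hm_top | hm_top
  · simp [hm_top, ENNReal.top_rpow_of_pos hδ, ENNReal.mul_top (geometricTailConst_ne_zero _ _), hab]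
  have hlevel (n : ℕ) : {x | ((2 : ℝ≥0∞) ^ δ) ^ n * m ^ δ < hlMaximal g x ^ δ} =
      {x | 2 ^ n * m < hlMaximal g x} := by
    ext x
    simp only [mem_ofPred_eq]
    rw [← ENNReal.rpow_natCast, ← ENNReal.rpow_mul, mul_comm δ, ENNReal.rpow_mul,
      ENNReal.rpow_natCast, ← ENNReal.mul_rpow_of_nonneg _ _ hδ.le, ENNReal.rpow_lt_rpow_iff hδ]
  have htail (n : ℕ) : volume.restrict (Icc a b) {x | 2 ^ n * m < hlMaximal g x} ≤
      15 * 2⁻¹ ^ n * volume.restrict (Icc a b) univ := by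
    have hweak := mul_measure_lt_hlMaximal_le g hab hy (2 ^ n * m)
    rw [mul_comm (2 ^ n : ℝ≥0∞), mul_assoc, mul_comm 15, mul_assoc,
      ENNReal.mul_le_mul_iff_right hm0 hm_top, mul_comm,
      ← ENNReal.le_div_iff_mul_le (.inl (by simp)) (.inl (by simp))] at hweak
    rw [Measure.restrict_apply_univ, Real.volume_Icc, ← ENNReal.inv_pow, mul_right_comm,
      ← div_eq_mul_inv, mul_comm (2 ^ n : ℝ≥0∞)]
    exact hweak
  have hmean := lintegral_le_of_geometric_tail (ν := volume.restrict (Icc a b))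
    (ENNReal.one_le_rpow one_le_two hδ) (ENNReal.rpow_pos (pos_iff_ne_zero.2 hm0) hm_top).ne'
    fun n => (hlevel n).symm ▸ htail n
  rwa [Measure.restrict_apply_univ, Real.volume_Icc] at hmean

lemma hlMaximal_le_of_forall_rat {g : ℝ → ℝ} {x : ℝ} {s : ℝ≥0∞}
    (h : ∀ p q : ℚ, (p : ℝ) < q → x ∈ Icc (p : ℝ) q →
      ⨍⁻ t in Icc (p : ℝ) q, ‖g t‖ₑ ∂volume ≤ s) :
    hlMaximal g x ≤ s := by
  rcases eq_or_ne s ⊤ with rfl | hs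
  · exact le_top
  refine hlMaximal_le_iff.2 fun a b hab hx => ?_
  have hlim : Tendsto (fun ε => s * ENNReal.ofReal (b - a + 2 * ε)) (𝓝[>] 0)
      (𝓝 (s * ENNReal.ofReal (b - a))) := by
    have hcont : Continuous fun ε => ENNReal.ofReal (b - a + 2 * ε) :=
      ENNReal.continuous_ofReal.comp (by fun_prop)
    exact ENNReal.Tendsto.const_mul
      (by simpa using (hcont.tendsto 0).mono_left nhdsWithin_le_nhds) (.inr hs)
  refine ge_of_tendsto hlim ?_
  filter_upwards [self_mem_nhdsWithin] with ε hε
  obtain ⟨p, hp_gt, hp_lt⟩ := exists_rat_btwn (sub_lt_self a hε)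
  obtain ⟨q, hq_gt, hq_lt⟩ := exists_rat_btwn (lt_add_of_pos_right b hε)
  have hpq : (p : ℝ) < q := hp_lt.trans (hab.trans hq_gt)
  calc ∫⁻ t in Icc a b, ‖g t‖ₑ ≤ ∫⁻ t in Icc (p : ℝ) q, ‖g t‖ₑ :=
        lintegral_mono_set (Icc_subset_Icc hp_lt.le hq_gt.le)
    _ ≤ s * ENNReal.ofReal (q - p) := (setLAverage_Icc_le_iff hpq _ _).1
        (h p q hpq ⟨hp_lt.le.trans hx.1, hx.2.trans hq_gt.le⟩)
    _ ≤ s * ENNReal.ofReal (b - a + 2 * ε) := by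
        gcongr
        linarith

lemma hlMaximal_eq_iSup_rat (g : ℝ → ℝ) :
    hlMaximal g = fun x => ⨆ (p : ℚ) (q : ℚ) (_ : (p : ℝ) < q),
      (Icc (p : ℝ) q).indicator (fun _ => ⨍⁻ t in Icc (p : ℝ) q, ‖g t‖ₑ ∂volume) x := by
  ext x
  refine le_antisymm (hlMaximal_le_of_forall_rat fun p q hpq hx => ?_) ?_
  · refine le_iSup_of_le p (le_iSup₂_of_le q hpq ?_)
    rw [indicator_of_mem hx]
  · exact iSup_le fun p => iSup₂_le fun q hpq =>
      indicator_apply_le fun hx => setLAverage_le_hlMaximal g hpq hx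

lemma measurable_hlMaximal (g : ℝ → ℝ) : Measurable (hlMaximal g) := by
  rw [hlMaximal_eq_iSup_rat]
  exact .iSup fun p => .iSup fun q => .iSup fun _ => measurable_const.indicator measurableSet_Icc

lemma ae_enorm_le_hlMaximal {g : ℝ → ℝ} (hg : LocallyIntegrable g) :
    ∀ᵐ x, ‖g x‖ₑ ≤ hlMaximal g x := by
  filter_upwards [ae_tendsto_setAverage_Icc hg] with x hlim
  have hlt (n : ℕ) : x < x + 1 / ((n : ℝ) + 1) := lt_add_of_pos_right x (by positivity)
  have havg := hlim (fun _ => x) (fun n : ℕ => x + 1 / ((n : ℝ) + 1)) hlt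
    (fun n => ⟨le_rfl, (hlt n).le⟩)
    (by simpa using tendsto_one_div_add_atTop_nhds_zero_nat (𝕜 := ℝ))
  refine le_of_tendsto havg.enorm (.of_forall fun n => ?_)
  exact (enorm_integral_le_lintegral_enorm _).trans
    (setLAverage_le_hlMaximal g (hlt n) ⟨le_rfl, (hlt n).le⟩)

lemma HasA1Bound.ae_hlMaximal_le {w : ℝ → ℝ} {K : ℝ≥0∞} (h : HasA1Bound (fun x => ‖w x‖ₑ) K) :
    ∀ᵐ x, hlMaximal w x ≤ K * ‖w x‖ₑ := by
  have hrat : ∀ᵐ x, ∀ p q : ℚ, (p : ℝ) < q → x ∈ Icc (p : ℝ) q →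
      ⨍⁻ t in Icc (p : ℝ) q, ‖w t‖ₑ ∂volume ≤ K * ‖w x‖ₑ := by
    simp only [ae_all_iff]
    exact fun p q hpq => (ae_restrict_iff' measurableSet_Icc).1 (h p q hpq)
  exact hrat.mono fun x hx => hlMaximal_le_of_forall_rat hx

lemma IsA1.exists_ae_hlMaximal_le {w : ℝ → ℝ} (hw : IsA1 w) :
    ∃ K ≠ ⊤, ∀ᵐ x, hlMaximal w x ≤ K * ENNReal.ofReal (w x) := by
  obtain ⟨K, hK, hbound⟩ := hw.exists_hasA1Bound
  simp only [← Real.enorm_of_nonneg (hw.nonneg _)] at hbound ⊢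
  exact ⟨K, hK, hbound.ae_hlMaximal_le⟩

/-! ### Logarithms of maximal functions -/

lemma IsLogMaximalDecomp.sub {f b g h : ℝ → ℝ} {α : ℝ} (hd : IsLogMaximalDecomp f α b g)
    (hh : MemLp h ⊤) : IsLogMaximalDecomp (f - h) α (b - h) g where
  pos := hd.pos
  memLp := hd.memLp.sub hh
  locallyIntegrable := hd.locallyIntegrable
  ae_eq := by
    filter_upwards [hd.ae_eq] with x hx
    rw [Pi.sub_apply, Pi.sub_apply, EReal.coe_sub, EReal.coe_sub, hx, sub_eq_add_neg, add_assoc,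
      ← sub_eq_add_neg]

lemma IsLogMaximalDecomp.ae_toReal_pos_and_eq {f b g : ℝ → ℝ} {α : ℝ}
    (hd : IsLogMaximalDecomp f α b g) :
    ∀ᵐ x, 0 < (hlMaximal g x).toReal ∧ f x = α * Real.log (hlMaximal g x).toReal + b x := by
  filter_upwards [hd.ae_eq] with x hx
  have hzero : hlMaximal g x ≠ 0 := by
    intro h
    rw [h, ENNReal.log_zero, EReal.coe_mul_bot_of_pos hd.pos, EReal.bot_add] at hx
    exact EReal.coe_ne_bot _ hx
  have htop : hlMaximal g x ≠ ⊤ := by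
    intro h
    rw [h, ENNReal.log_top, EReal.coe_mul_top_of_pos hd.pos, EReal.top_add_coe] at hx
    exact EReal.coe_ne_top _ hx
  have hpos := ENNReal.toReal_pos hzero htop
  rw [ENNReal.log_pos_real' hpos] at hx
  exact ⟨hpos, mod_cast hx⟩

lemma IsLogMaximalDecomp.aemeasurable {f b g : ℝ → ℝ} {α : ℝ} (hd : IsLogMaximalDecomp f α b g) :
    AEMeasurable f :=
  (((measurable_hlMaximal g).ennreal_toReal.log.const_mul α).aemeasurable.add
    hd.memLp.1.aemeasurable).congr (hd.ae_toReal_pos_and_eq.mono fun _ hx => hx.2.symm)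

lemma exists_ae_norm_le_of_memLp_top {X E : Type*} [MeasurableSpace X] {μ : Measure X}
    [NormedAddCommGroup E] {b : X → E} (hb : MemLp b ⊤ μ) : ∃ N : ℝ, ∀ᵐ x ∂μ, ‖b x‖ ≤ N := by
  refine ⟨(eLpNormEssSup b μ).toReal, ?_⟩
  have hfin : eLpNormEssSup b μ ≠ ⊤ := by simpa only [eLpNorm_exponent_top] using hb.2.ne
  filter_upwards [ae_le_eLpNormEssSup (f := b) (μ := μ)] with x hx
  simpa only [toReal_enorm] using ENNReal.toReal_mono hfin hx

lemma IsLogMaximalDecomp.ae_exp_div_eq {f b g : ℝ → ℝ} {α : ℝ} (hd : IsLogMaximalDecomp f α b g)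
    (μ : ℝ) : ∀ᵐ x, ENNReal.ofReal (Real.exp (f x / μ)) =
      ENNReal.ofReal (Real.exp (b x / μ)) * hlMaximal g x ^ (α / μ) := by
  filter_upwards [hd.ae_toReal_pos_and_eq] with x ⟨hpos, hfx⟩
  have htop : hlMaximal g x ≠ ⊤ := (ENNReal.toReal_pos_iff.1 hpos).2.ne
  conv_rhs => rw [← ENNReal.ofReal_toReal htop]
  rw [ENNReal.ofReal_rpow_of_pos hpos, ← ENNReal.ofReal_mul (Real.exp_pos _).le,
    Real.rpow_def_of_pos hpos, ← Real.exp_add, hfx]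
  ring_nf

lemma IsLogMaximalDecomp.exists_hasA1Bound_exp_div {f b g : ℝ → ℝ} {α μ : ℝ}
    (hd : IsLogMaximalDecomp f α b g) (hμ : α < μ) :
    ∃ K ≠ ⊤, HasA1Bound (fun x => ENNReal.ofReal (Real.exp (f x / μ))) K := by
  have hμ0 : 0 < μ := hd.pos.trans hμ
  have hrpow : (2 : ℝ≥0∞) ^ (α / μ) < 2 := by
    simpa using ENNReal.rpow_lt_rpow_of_exponent_lt (by norm_num : (1 : ℝ≥0∞) < 2)
      ENNReal.ofNat_ne_top ((div_lt_one hμ0).2 hμ)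
  have hK := geometricTailConst_ne_top (A := 15) ENNReal.ofNat_ne_top hrpow
  obtain ⟨N, hN⟩ := exists_ae_norm_le_of_memLp_top hd.memLp
  have hbN : ∀ᵐ x, |b x / μ| ≤ N / μ := by
    filter_upwards [hN] with x hx
    rw [abs_div, abs_of_pos hμ0]
    exact div_le_div_of_nonneg_right hx hμ0.le
  exact ⟨_, by finiteness, (hasA1Bound_hlMaximal_rpow g (div_pos hd.pos hμ0)).of_ae_eq_exp_mul hbN
    (hd.ae_exp_div_eq μ)⟩

lemma IsLogMaximalDecomp.isA1_exp_div {f b g : ℝ → ℝ} {α μ : ℝ}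
    (hd : IsLogMaximalDecomp f α b g) (hμ : α < μ) : IsA1 fun x => Real.exp (f x / μ) := by
  obtain ⟨K, hK, hbound⟩ := hd.exists_hasA1Bound_exp_div hμ
  exact hbound.isA1 hK (fun x => (Real.exp_pos _).le) (ae_of_all _ fun x => Real.exp_pos _)
    (Real.measurable_exp.comp_aemeasurable (hd.aemeasurable.div_const μ))

lemma IsA1.exists_ae_abs_log_hlMaximal_sub_log_le {w : ℝ → ℝ} (hw : IsA1 w) :
    ∃ N, ∀ᵐ x, 0 < (hlMaximal w x).toReal ∧
      |Real.log (hlMaximal w x).toReal - Real.log (w x)| ≤ N := by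
  obtain ⟨K, hK, hupper⟩ := hw.exists_ae_hlMaximal_le
  refine ⟨Real.log K.toReal, ?_⟩
  filter_upwards [hupper, ae_enorm_le_hlMaximal hw.locallyIntegrable, hw.ae_pos] with x hle hge hwx
  have hKw : K * ENNReal.ofReal (w x) ≠ ⊤ := ENNReal.mul_ne_top hK ENNReal.ofReal_ne_top
  have hlower : w x ≤ (hlMaximal w x).toReal := by
    rwa [Real.enorm_of_nonneg hwx.le,
      ENNReal.ofReal_le_iff_le_toReal (ne_top_of_le_ne_top hKw hle)] at hge
  have hpos : 0 < (hlMaximal w x).toReal := hwx.trans_le hlower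
  have hupper' : (hlMaximal w x).toReal ≤ K.toReal * w x := by
    simpa [ENNReal.toReal_ofReal hwx.le] using ENNReal.toReal_mono hKw hle
  have hKpos : 0 < K.toReal := pos_of_mul_pos_left (hpos.trans_le hupper') hwx.le
  have hlog := Real.log_le_log hpos hupper'
  rw [Real.log_mul hKpos.ne' hwx.ne'] at hlog
  rw [abs_of_nonneg (sub_nonneg.2 (Real.log_le_log hwx hlower))]
  exact ⟨hpos, by linarith⟩

lemma IsA1.exists_isLogMaximalDecomp {f : ℝ → ℝ} {μ : ℝ} (hμ : 0 < μ)
    (hw : IsA1 fun x => Real.exp (f x / μ)) :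
    ∃ b, IsLogMaximalDecomp f μ b fun x => Real.exp (f x / μ) := by
  set w : ℝ → ℝ := fun x => Real.exp (f x / μ)
  have hf (x : ℝ) : μ * Real.log (w x) = f x := by
    rw [Real.log_exp, mul_div_cancel₀ _ hμ.ne']
  obtain ⟨N, hN⟩ := hw.exists_ae_abs_log_hlMaximal_sub_log_le
  refine ⟨fun x => μ * (Real.log (w x) - Real.log (hlMaximal w x).toReal), hμ, ?_,
    hw.locallyIntegrable, ?_⟩
  · refine memLp_top_of_bound (C := μ * N) ?_ ?_
    · exact ((hw.locallyIntegrable.aestronglyMeasurable.aemeasurable.log.sub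
        (measurable_hlMaximal w).ennreal_toReal.log.aemeasurable).const_mul μ).aestronglyMeasurable
    · filter_upwards [hN] with x ⟨_, hx⟩
      rw [norm_mul, Real.norm_of_nonneg hμ.le, Real.norm_eq_abs, abs_sub_comm]
      gcongr
  · filter_upwards [hN] with x ⟨hpos, _⟩
    rw [ENNReal.log_pos_real' hpos, mul_sub, hf]
    norm_cast
    ring

lemma distNewLinfty_eq_iInf (f : ℝ → ℝ) :
    distNewLinfty f =
      ⨅ (α : ℝ) (b : ℝ → ℝ) (g : ℝ → ℝ) (_ : IsLogMaximalDecomp f α b g), ENNReal.ofReal α := by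
  refine le_antisymm (le_iInf₂ fun α b => le_iInf₂ fun g hd => ?_)
    (le_iInf₂ fun h hh => le_iInf₂ fun α b => le_iInf₂ fun g hd => ?_)
  · refine iInf₂_le_of_le b hd.memLp (iInf₂_le_of_le α (b - b) (iInf₂_le_of_le g
      (hd.sub hd.memLp) ?_))
    simp
  · have hd' : IsLogMaximalDecomp f α (b + h) g := by
      simpa [sub_eq_add_neg] using hd.sub hh.neg
    exact (iInf₂_le_of_le α (b + h) (iInf₂_le g hd')).trans le_self_add

theorem mainTheorem1_general (f : ℝ → ℝ) : distNewLinfty f = sigmaA1 f := by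
  rw [distNewLinfty_eq_iInf]
  refine le_antisymm (le_iInf₂ fun μ hμ => le_iInf fun hw => ?_)
    (le_iInf₂ fun α b => le_iInf₂ fun g hd => ?_)
  · obtain ⟨b, hd⟩ := hw.exists_isLogMaximalDecomp hμ
    exact iInf₂_le_of_le μ b (iInf₂_le _ hd)
  · have hlim : Tendsto ENNReal.ofReal (𝓝[>] α) (𝓝 (ENNReal.ofReal α)) :=
      (ENNReal.continuous_ofReal.tendsto α).mono_left nhdsWithin_le_nhds
    refine ge_of_tendsto hlim ?_
    filter_upwards [self_mem_nhdsWithin] with μ hμ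
    exact iInf₂_le_of_le μ (hd.pos.trans hμ) (iInf_le _ (hd.isA1_exp_div hμ))

theorem mainTheorem1 (f : ℝ → ℝ) (hf : IsBLO f) :
    distNewLinfty f = sigmaA1 f ∧ sigmaA1 f < ⊤ :=
  ⟨mainTheorem1_general f, hf.sigmaA1_lt_top⟩
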